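/- Let $n\ge 3$. An $n$-segment is a point $(z_1,\dots,z_n)\in\mathbb{C}^n$ whose entries $z_1,\dots,z_n$ lie on a common real line in $\mathbb{C}$ and are not all equal. Let $\mathbb{M}(n)\subset\mathbb{C}^n$ be the set of $n$-segments with $z_1=0$. Then $\mathbb{M}(n)$ is a smooth embedded real submanifold of $\mathbb{C}^n$ of dimension $n$. Moreover, let $$T=\Big(\big(\mathbb{R}^{n-1}\smallsetminus\{0\}\big)\times[0,\pi]\Big)\Big/\big((X,0)\sim(-X,\pi)\big)$$ be the mapping torus of $X\mapsto -X$, with its standard smooth structure, given by the two charts $[X,\theta]\mapsto(X,\theta)$ on $\{0<\theta<\pi\}$ and, on $\{\theta\ne\pi/2\}$, $[X,\theta]\mapsto(X,\theta)$ if $\theta<\pi/2$ and $[X,\theta]\mapsto(-X,\theta-\pi)$ if $\theta>\pi/2$. Then the map $$T\to\mathbb{M}(n),\qquad [(x_1,\dots,x_{n-1}),\theta]\mapsto\big(0,e^{i\theta}x_1,\dots,e^{i\theta}x_{n-1}\big),$$ is well defined and is a smooth diffeomorphism. -/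

import Mathlib

open scoped Manifold ContDiff

noncomputable section

/-! Polygons with `n` labelled vertices are points of `ℂⁿ`, written `Fin n → ℂ`; only its topology
and its smooth structure as a real vector space are used. -/

/-- `𝕃(n)`: the set of `n`-segments, i.e. of the nonconstant `n`-tuples of points of the plane
that lie on a common real line. -/
def nSegments (n : ℕ) : Set (Fin n → ℂ) :=
  {Z | Collinear ℝ (Set.range Z) ∧ ∃ i j, Z i ≠ Z j}

/-- `𝕄(n)`: the set of `n`-segments whose first vertex is `0`. -/
def pointedSegments (n : ℕ) : Set (Fin n → ℂ) :=
  {Z | Z ∈ nSegments n ∧ ∀ j : Fin n, (j : ℕ) = 0 → Z j = 0}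

/-- `ℝᵏ ∖ {0}`. -/
abbrev PuncturedSpace (k : ℕ) : Type := {X : Fin k → ℝ // X ≠ 0}

/-- The relation `(X, 0) ∼ (-X, π)` on `(ℝᵏ ∖ {0}) × [0, π]`. -/
def TorusRel (k : ℕ) (p q : PuncturedSpace k × Set.Icc (0 : ℝ) Real.pi) : Prop :=
  (p.2 : ℝ) = 0 ∧ (q.2 : ℝ) = Real.pi ∧ q.1.1 = -p.1.1

/-- The mapping torus `((ℝᵏ ∖ {0}) × [0, π]) / ((X, 0) ∼ (-X, π))`: the quotient by the equivalence
relation generated by `TorusRel k`. -/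
def PuncturedTorus (k : ℕ) : Type := Quot (TorusRel k)

namespace PuncturedTorus

variable {k : ℕ}

/-- The quotient topology. -/
instance : TopologicalSpace (PuncturedTorus k) :=
  inferInstanceAs (TopologicalSpace (Quot (TorusRel k)))

/-- The class of `(X, θ)`. -/
def mk (p : PuncturedSpace k × Set.Icc (0 : ℝ) Real.pi) : PuncturedTorus k := Quot.mk _ p

theorem continuous_mk : Continuous (mk : _ → PuncturedTorus k) := continuous_quot_mk

theorem mk_eq {X Y : PuncturedSpace k} {s t : Set.Icc (0 : ℝ) Real.pi} (hs : (s : ℝ) = 0)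
    (ht : (t : ℝ) = Real.pi) (h : Y.1 = -X.1) : mk (X, s) = mk (Y, t) :=
  Quot.sound ⟨hs, ht, h⟩

/-- `[X, θ]` with `X` and `θ` arbitrary: `θ` is clamped to `[0, π]`, and the value is the
irrelevant `p` if `X = 0`. -/
def point (p : PuncturedTorus k) (X : Fin k → ℝ) (θ : ℝ) : PuncturedTorus k :=
  open Classical in
  if h : X ≠ 0 then mk (⟨X, h⟩, Set.projIcc 0 Real.pi Real.pi_pos.le θ) else p

theorem point_eq (p : PuncturedTorus k) (x : PuncturedSpace k × Set.Icc (0 : ℝ) Real.pi) :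
    point p x.1.1 x.2.1 = mk x := by
  simp [point, x.1.2]

theorem continuousOn_point (p : PuncturedTorus k) :
    ContinuousOn (fun x : (Fin k → ℝ) × ℝ => point p x.1 x.2) {x | x.1 ≠ 0} := by
  rw [continuousOn_iff_continuous_domRestrict]
  have : Set.domRestrict {x : (Fin k → ℝ) × ℝ | x.1 ≠ 0} (fun x => point p x.1 x.2) =
      fun x => mk (⟨x.1.1, x.2⟩, Set.projIcc 0 Real.pi Real.pi_pos.le x.1.2) := by
    funext x
    have hx : x.1.1 ≠ 0 := x.2
    simp [Set.domRestrict, point, hx]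
  rw [this]
  refine continuous_mk.comp (Continuous.prodMk ?_ ?_)
  · fun_prop
  · exact continuous_projIcc.comp (by fun_prop)

/-- The coordinates of `[X, θ]` in the chart over `0 < θ < π`: the pair `(X, θ)`. -/
def coordA : PuncturedTorus k → (Fin k → ℝ) × ℝ :=
  Quot.lift (fun p => if 0 < (p.2 : ℝ) ∧ (p.2 : ℝ) < Real.pi then (p.1.1, (p.2 : ℝ)) else 0) (by
    rintro p q ⟨h1, h2, -⟩
    simp [h1, h2])

/-- The coordinates of `[X, θ]` in the chart over `θ ≠ π / 2`: the pair `(X, θ)` if `θ < π / 2`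
and the pair `(-X, θ - π)` if `θ > π / 2`. -/
def coordB : PuncturedTorus k → (Fin k → ℝ) × ℝ :=
  Quot.lift (fun p => if (p.2 : ℝ) < Real.pi / 2 then (p.1.1, (p.2 : ℝ))
    else (-p.1.1, (p.2 : ℝ) - Real.pi)) (by
    rintro p q ⟨h1, h2, h3⟩
    have := Real.pi_pos
    simp [h1, h2, h3, this, not_lt.2 (half_lt_self this).le])

/-- The inverse of `coordB`: it sends `(X, t)` to `[X, t]` if `0 ≤ t` and to `[-X, t + π]` if
`t < 0`. -/
def pointB (p : PuncturedTorus k) (X : Fin k → ℝ) (t : ℝ) : PuncturedTorus k :=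
  if 0 ≤ t then point p X t else point p (-X) (t + Real.pi)

theorem coordA_mk (x : PuncturedSpace k × Set.Icc (0 : ℝ) Real.pi) :
    coordA (mk x) = if 0 < (x.2 : ℝ) ∧ (x.2 : ℝ) < Real.pi then (x.1.1, (x.2 : ℝ)) else 0 := rfl

theorem coordB_mk (x : PuncturedSpace k × Set.Icc (0 : ℝ) Real.pi) :
    coordB (mk x) = if (x.2 : ℝ) < Real.pi / 2 then (x.1.1, (x.2 : ℝ))
      else (-x.1.1, (x.2 : ℝ) - Real.pi) := rfl

/-- `(ℝᵏ ∖ {0}) × (a, b)`. -/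
def slab (k : ℕ) (a b : ℝ) : Set ((Fin k → ℝ) × ℝ) := {x | x.1 ≠ 0 ∧ a < x.2 ∧ x.2 < b}

theorem isOpen_slab (a b : ℝ) : IsOpen (slab k a b) :=
  (isOpen_ne_fun continuous_fst continuous_const).inter
    ((isOpen_lt continuous_const continuous_snd).inter (isOpen_lt continuous_snd continuous_const))

theorem coordA_mem_iff (x : PuncturedSpace k × Set.Icc (0 : ℝ) Real.pi) :
    coordA (mk x) ∈ slab k 0 Real.pi ↔ 0 < (x.2 : ℝ) ∧ (x.2 : ℝ) < Real.pi := by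
  rw [coordA_mk]
  split_ifs with h
  · simp [slab, h, x.1.2]
  · simp [slab, h]

theorem coordB_mem_iff (x : PuncturedSpace k × Set.Icc (0 : ℝ) Real.pi) :
    coordB (mk x) ∈ slab k (-(Real.pi / 2)) (Real.pi / 2) ↔ (x.2 : ℝ) ≠ Real.pi / 2 := by
  have h0 := x.2.2.1
  have h1 := x.2.2.2
  have := Real.pi_pos
  rw [coordB_mk]
  split_ifs with h
  · simp only [slab, Set.mem_ofPred_eq]
    exact ⟨fun _ => h.ne, fun _ => ⟨x.1.2, by linarith, h⟩⟩
  · simp only [slab, Set.mem_ofPred_eq]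
    refine ⟨fun h' h'' => ?_, fun h' => ⟨neg_ne_zero.2 x.1.2, ?_, ?_⟩⟩
    · linarith [h'.2.1]
    · linarith [lt_of_le_of_ne (not_lt.1 h) (Ne.symm h')]
    · linarith

theorem isOpen_iff (U : Set (PuncturedTorus k)) : IsOpen U ↔ IsOpen (mk ⁻¹' U) :=
  isQuotientMap_quot_mk.isOpen_preimage.symm

theorem continuousOn_of_mk {α : Type*} [TopologicalSpace α] {U : Set (PuncturedTorus k)}
    (hU : IsOpen U) {f : PuncturedTorus k → α} (h : ContinuousOn (f ∘ mk) (mk ⁻¹' U)) :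
    ContinuousOn f U := by
  rw [continuousOn_open_iff hU]
  intro t ht
  rw [isOpen_iff]
  exact (continuousOn_open_iff (continuous_mk.isOpen_preimage _ hU)).1 h t ht

theorem isOpen_sourceA : IsOpen ((coordA : PuncturedTorus k → _) ⁻¹' slab k 0 Real.pi) := by
  have : (mk : _ → PuncturedTorus k) ⁻¹' (coordA ⁻¹' slab k 0 Real.pi) =
      {x | 0 < (x.2 : ℝ)} ∩ {x | (x.2 : ℝ) < Real.pi} := Set.ext coordA_mem_iff
  rw [isOpen_iff, this]
  exact (isOpen_lt (by fun_prop) (by fun_prop)).inter (isOpen_lt (by fun_prop) (by fun_prop))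

theorem coordA_point (p : PuncturedTorus k) {x : (Fin k → ℝ) × ℝ} (hx : x ∈ slab k 0 Real.pi) :
    coordA (point p x.1 x.2) = x := by
  obtain ⟨X, t⟩ := x
  obtain ⟨hX, ht⟩ := hx
  have := point_eq p (⟨X, hX⟩, ⟨t, ht.1.le, ht.2.le⟩)
  dsimp only at this ⊢
  rw [this]
  exact if_pos ht

/-- The chart `[X, θ] ↦ (X, θ)`, from the classes with `0 < θ < π` onto `(ℝᵏ ∖ {0}) × (0, π)`.
The point `p` only serves as a value of the inverse outside its domain. -/
def chartA (p : PuncturedTorus k) :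
    OpenPartialHomeomorph (PuncturedTorus k) ((Fin k → ℝ) × ℝ) where
  toFun := coordA
  invFun x := point p x.1 x.2
  source := coordA ⁻¹' slab k 0 Real.pi
  target := slab k 0 Real.pi
  map_source' _ h := h
  map_target' x hx := by
    rw [Set.mem_preimage, coordA_point p hx]
    exact hx
  left_inv' := by
    rintro ⟨x⟩ hx
    change coordA (mk x) ∈ slab k 0 Real.pi at hx
    change point p (coordA (mk x)).1 (coordA (mk x)).2 = mk x
    rw [coordA_mk, if_pos ((coordA_mem_iff x).1 hx)]
    exact point_eq p x
  right_inv' x hx := coordA_point p hx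
  open_source := isOpen_sourceA
  open_target := isOpen_slab _ _
  continuousOn_toFun := by
    refine continuousOn_of_mk isOpen_sourceA ?_
    refine ContinuousOn.congr (f := fun x => (x.1.1, (x.2 : ℝ))) (by fun_prop) fun x hx => ?_
    exact if_pos ((coordA_mem_iff x).1 hx)
  continuousOn_invFun := (continuousOn_point p).mono fun x hx => hx.1

theorem isOpen_sourceB :
    IsOpen ((coordB : PuncturedTorus k → _) ⁻¹' slab k (-(Real.pi / 2)) (Real.pi / 2)) := by
  have : (mk : _ → PuncturedTorus k) ⁻¹' (coordB ⁻¹' slab k (-(Real.pi / 2)) (Real.pi / 2)) =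
      {x | (x.2 : ℝ) ≠ Real.pi / 2} := Set.ext coordB_mem_iff
  rw [isOpen_iff, this]
  exact isOpen_ne_fun (by fun_prop) (by fun_prop)

theorem coordB_pointB (p : PuncturedTorus k) {x : (Fin k → ℝ) × ℝ}
    (hx : x ∈ slab k (-(Real.pi / 2)) (Real.pi / 2)) : coordB (pointB p x.1 x.2) = x := by
  obtain ⟨X, t⟩ := x
  obtain ⟨hX, h1, h2⟩ := hx
  dsimp only at hX h1 h2 ⊢
  have := Real.pi_pos
  unfold pointB
  split_ifs with ht
  · have h := point_eq p (⟨X, hX⟩, ⟨t, ht, by linarith⟩)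
    dsimp only at h
    rw [h, coordB_mk, if_pos h2]
  · have h := point_eq p (⟨-X, neg_ne_zero.2 hX⟩, ⟨t + Real.pi, by linarith, by linarith⟩)
    dsimp only at h
    rw [h, coordB_mk, if_neg (by dsimp only; linarith)]
    simp

/-- The chart given by `[X, θ] ↦ (X, θ)` for `θ < π / 2` and by `[X, θ] ↦ (-X, θ - π)` for
`θ > π / 2`, from the classes with `θ ≠ π / 2` onto `(ℝᵏ ∖ {0}) × (-π / 2, π / 2)`.
The point `p` only serves as a value of the inverse outside its domain. -/
def chartB (p : PuncturedTorus k) :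
    OpenPartialHomeomorph (PuncturedTorus k) ((Fin k → ℝ) × ℝ) where
  toFun := coordB
  invFun x := pointB p x.1 x.2
  source := coordB ⁻¹' slab k (-(Real.pi / 2)) (Real.pi / 2)
  target := slab k (-(Real.pi / 2)) (Real.pi / 2)
  map_source' _ h := h
  map_target' x hx := by
    rw [Set.mem_preimage, coordB_pointB p hx]
    exact hx
  left_inv' := by
    rintro ⟨x⟩ hx
    change coordB (mk x) ∈ slab k (-(Real.pi / 2)) (Real.pi / 2) at hx
    change pointB p (coordB (mk x)).1 (coordB (mk x)).2 = mk x
    have hx := (coordB_mem_iff x).1 hx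
    have hp := point_eq p x
    have h0 := x.2.2.1
    have h1 := x.2.2.2
    rw [coordB_mk]
    split_ifs with h
    · rw [pointB, if_pos h0, hp]
    · unfold pointB
      dsimp only
      split_ifs with h'
      · have ht : (x.2 : ℝ) = Real.pi := by linarith
        have hq := point_eq p (⟨-x.1.1, neg_ne_zero.2 x.1.2⟩, ⟨0, le_rfl, Real.pi_pos.le⟩)
        dsimp only at hq
        rw [ht, sub_self, hq]
        exact mk_eq rfl ht (by simp)
      · rw [neg_neg, sub_add_cancel, hp]
  right_inv' x hx := coordB_pointB p hx
  open_source := isOpen_sourceB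
  open_target := isOpen_slab _ _
  continuousOn_toFun := by
    refine continuousOn_of_mk isOpen_sourceB fun x hx => ContinuousAt.continuousWithinAt ?_
    have hx := (coordB_mem_iff x).1 hx
    rcases lt_or_gt_of_ne hx with h | h
    · have hc : ContinuousAt (fun x : PuncturedSpace k × Set.Icc (0 : ℝ) Real.pi =>
          (x.1.1, (x.2 : ℝ))) x := by fun_prop
      refine hc.congr ?_
      filter_upwards [(isOpen_lt (by fun_prop) (by fun_prop) :
        IsOpen {y : PuncturedSpace k × Set.Icc (0 : ℝ) Real.pi | (y.2 : ℝ) < Real.pi / 2}).mem_nhds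
        h] with y hy
      exact (if_pos hy).symm
    · have hc : ContinuousAt (fun x : PuncturedSpace k × Set.Icc (0 : ℝ) Real.pi =>
          (-x.1.1, (x.2 : ℝ) - Real.pi)) x := by fun_prop
      refine hc.congr ?_
      filter_upwards [(isOpen_lt (by fun_prop) (by fun_prop) :
        IsOpen {y : PuncturedSpace k × Set.Icc (0 : ℝ) Real.pi | Real.pi / 2 < (y.2 : ℝ)}).mem_nhds
        h] with y hy
      exact (if_neg (not_lt.2 (le_of_lt hy))).symm
  continuousOn_invFun := by
    have h1 := continuousOn_point p
    have h2 : ContinuousOn (fun x : (Fin k → ℝ) × ℝ => point p (-x.1) (x.2 + Real.pi))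
        {x | x.1 ≠ 0} :=
      h1.comp (f := fun x : (Fin k → ℝ) × ℝ => (-x.1, x.2 + Real.pi)) (by fun_prop)
        fun x hx => neg_ne_zero.2 hx
    refine ContinuousOn.if (p := fun x : (Fin k → ℝ) × ℝ => 0 ≤ x.2) ?_
      (h1.mono fun x hx => hx.1.1) (h2.mono fun x hx => hx.1.1)
    rintro ⟨X, t⟩ ⟨⟨hX, -⟩, ht⟩
    obtain rfl : (0 : ℝ) = t := frontier_le_subset_eq continuous_const continuous_snd ht
    have hp := point_eq p (⟨X, hX⟩, ⟨0, le_rfl, Real.pi_pos.le⟩)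
    have hq := point_eq p (⟨-X, neg_ne_zero.2 hX⟩, ⟨Real.pi, Real.pi_pos.le, le_rfl⟩)
    dsimp only at hp hq ⊢
    rw [zero_add, hp, hq]
    exact mk_eq rfl rfl rfl

theorem coordB_point (p : PuncturedTorus k) {x : (Fin k → ℝ) × ℝ} (hx : x ∈ slab k 0 Real.pi) :
    coordB (point p x.1 x.2) =
      if x.2 < Real.pi / 2 then x else (-x.1, x.2 - Real.pi) := by
  have h := point_eq p (⟨x.1, hx.1⟩, ⟨x.2, hx.2.1.le, hx.2.2.le⟩)
  dsimp only at h
  rw [h, coordB_mk]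

theorem coordA_pointB (p : PuncturedTorus k) {x : (Fin k → ℝ) × ℝ}
    (hx : x ∈ slab k (-(Real.pi / 2)) (Real.pi / 2)) (h0 : x.2 ≠ 0) :
    coordA (pointB p x.1 x.2) = if 0 < x.2 then x else (-x.1, x.2 + Real.pi) := by
  obtain ⟨hX, h1, h2⟩ := hx
  have := Real.pi_pos
  rcases lt_or_gt_of_ne h0 with h | h
  · rw [pointB, if_neg (not_le.2 h), if_neg (not_lt.2 h.le)]
    exact coordA_point p (x := (-x.1, x.2 + Real.pi))
      ⟨neg_ne_zero.2 hX, by dsimp only; linarith, by dsimp only; linarith⟩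
  · rw [pointB, if_pos h.le, if_pos h]
    exact coordA_point p ⟨hX, h, by linarith⟩

/-- A map that near each point of `s` is one of two smooth maps, according to the position of
`x.2` relative to `c`, is smooth on `s`. -/
theorem contDiffOn_of_cases {E F : Type*} [NormedAddCommGroup E] [NormedSpace ℝ E]
    [NormedAddCommGroup F] [NormedSpace ℝ F] {f g₁ g₂ : E × ℝ → F} {s : Set (E × ℝ)}
    (hs : IsOpen s) (c : ℝ) (hc : ∀ x ∈ s, x.2 ≠ c) (h₁ : ContDiff ℝ ∞ g₁) (h₂ : ContDiff ℝ ∞ g₂)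
    (hf₁ : ∀ x ∈ s, x.2 < c → f x = g₁ x) (hf₂ : ∀ x ∈ s, c < x.2 → f x = g₂ x) :
    ContDiffOn ℝ ∞ f s := by
  intro x hx
  refine ContDiffAt.contDiffWithinAt ?_
  rcases lt_or_gt_of_ne (hc x hx) with h | h
  · refine h₁.contDiffAt.congr_of_eventuallyEq ?_
    filter_upwards [hs.mem_nhds hx, (isOpen_lt continuous_snd continuous_const).mem_nhds h]
      with y hy hy' using hf₁ y hy hy'
  · refine h₂.contDiffAt.congr_of_eventuallyEq ?_
    filter_upwards [hs.mem_nhds hx, (isOpen_lt continuous_const continuous_snd).mem_nhds h]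
      with y hy hy' using hf₂ y hy hy'

/-- The smooth structure of the mapping torus, given by the two charts above. -/
instance : ChartedSpace ((Fin k → ℝ) × ℝ) (PuncturedTorus k) where
  atlas := Set.range chartA ∪ Set.range chartB
  chartAt p := open Classical in if p ∈ (chartB p).source then chartB p else chartA p
  mem_chart_source p := by
    split_ifs with h
    · exact h
    · obtain ⟨x, rfl⟩ : ∃ x, mk x = p := Quot.exists_rep p
      have hx : (x.2 : ℝ) = Real.pi / 2 := by
        by_contra hx
        exact h ((coordB_mem_iff x).2 hx)
      refine (coordA_mem_iff x).2 ?_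
      rw [hx]
      exact ⟨half_pos Real.pi_pos, half_lt_self Real.pi_pos⟩
  chart_mem_atlas p := by
    split_ifs
    · exact Or.inr ⟨p, rfl⟩
    · exact Or.inl ⟨p, rfl⟩

instance : IsManifold 𝓘(ℝ, (Fin k → ℝ) × ℝ) ∞ (PuncturedTorus k) := by
  refine isManifold_of_contDiffOn _ _ _ ?_
  intro e e' he he'
  have hs : 𝓘(ℝ, (Fin k → ℝ) × ℝ).symm ⁻¹' (e.symm ≫ₕ e').source ∩
      Set.range 𝓘(ℝ, (Fin k → ℝ) × ℝ) = (e.symm ≫ₕ e').source := by simp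
  rw [hs]
  have ho := (e.symm ≫ₕ e').open_source
  rcases he with ⟨p, rfl⟩ | ⟨p, rfl⟩ <;> rcases he' with ⟨q, rfl⟩ | ⟨q, rfl⟩
  · exact contDiffOn_id.congr fun x hx => coordA_point p hx.1
  · refine contDiffOn_of_cases ho (Real.pi / 2) (g₁ := id)
      (g₂ := fun x => (-x.1, x.2 - Real.pi)) ?_ contDiff_id (by fun_prop) ?_ ?_
    · rintro x ⟨hx, hx'⟩ h
      have h' : coordB (point p x.1 x.2) ∈ slab k (-(Real.pi / 2)) (Real.pi / 2) := hx'
      rw [coordB_point p hx, if_neg (not_lt.2 h.ge)] at h'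
      have := h'.2.1
      dsimp only at this
      linarith
    · exact fun x hx h => (coordB_point p hx.1).trans (if_pos h)
    · exact fun x hx h => (coordB_point p hx.1).trans (if_neg (not_lt.2 h.le))
  · have hne : ∀ x ∈ ((chartB p).symm ≫ₕ chartA q).source, x.2 ≠ 0 := by
      rintro x ⟨hx, hx'⟩ h
      have h' : coordA (pointB p x.1 x.2) ∈ slab k 0 Real.pi := hx'
      have hp := point_eq p (⟨x.1, hx.1⟩, ⟨0, le_rfl, Real.pi_pos.le⟩)
      dsimp only at hp
      rw [h, pointB, if_pos le_rfl, hp, coordA_mem_iff] at h'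
      exact lt_irrefl _ h'.1
    refine contDiffOn_of_cases ho 0 (g₁ := fun x => (-x.1, x.2 + Real.pi)) (g₂ := id)
      hne (by fun_prop) contDiff_id ?_ ?_
    · exact fun x hx h => (coordA_pointB p hx.1 (hne x hx)).trans (if_neg (not_lt.2 h.le))
    · exact fun x hx h => (coordA_pointB p hx.1 (hne x hx)).trans (if_pos h)
  · exact contDiffOn_id.congr fun x hx => coordB_pointB p hx.1

end PuncturedTorus

/-- The `n`-tuple `(0, e^{iθ} x₁, …, e^{iθ} xₙ₋₁)`, that is `e^{iθ} X` with a first vertex `0`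
prepended. -/
def rotatedSegment (n : ℕ) (X : Fin (n - 1) → ℝ) (θ : ℝ) : Fin n → ℂ := fun j =>
  if h : (j : ℕ) = 0 then 0
  else Complex.exp (θ * Complex.I) * X ⟨(j : ℕ) - 1, by omega⟩

end

/-!
For `Z = (0, e^{iθ} X)` the sum of the squares of the entries is `e^{2iθ} |X|² ≠ 0`. Hence the
direction `θ` modulo `π` extends smoothly to the open set of all `Z ∈ ℂⁿ` at which
`∑_{j > 1} Z_j² ≠ 0`: it is half the argument of this sum. Rotating back by `θ` turns
`(Z_2, …, Z_n)` into `x + i y` with real vectors `x ⊥ y` and `|y| < |x|`, and `Z` lies in `𝕄(n)`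
exactly if `y = 0` and `Z_1 = 0`. The vectors `y ⊥ x` do not form a fixed vector space, but
`f = y + (Re Z_1) x` ranges over an open subset of `ℝⁿ⁻¹` and determines both `y` and `Re Z_1`. So
`((x, θ), (f, Im Z_1))` are slice coordinates for `𝕄(n)`, and `(x, θ)` are also the coordinates of
the mapping torus: the map of the theorem is the identity in these coordinates.
-/

noncomputable section

section Slices

variable {𝕜 : Type*} [NontriviallyNormedField 𝕜] {n : ℕ∞ω}
  {V : Type*} [NormedAddCommGroup V] [NormedSpace 𝕜 V]
  {E : Type*} [NormedAddCommGroup E] [NormedSpace 𝕜 E]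
  {E' : Type*} [NormedAddCommGroup E'] [NormedSpace 𝕜 E']
  {F : Type*} [NormedAddCommGroup F] [NormedSpace 𝕜 F]
  {S : Set V}

variable (𝕜 n) in
/-- `e` is a slice chart for `S`: a local diffeomorphism of class `C^n` from the ambient space `V`
to `E × F` that straightens `S` to the slice `E × {0}`. -/
structure IsSliceChart (S : Set V) (e : OpenPartialHomeomorph V (E × F)) : Prop where
  contDiffOn : ContDiffOn 𝕜 n e e.source
  contDiffOn_symm : ContDiffOn 𝕜 n e.symm e.target
  mem_iff : ∀ z ∈ e.source, z ∈ S ↔ (e z).2 = 0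

namespace IsSliceChart

variable {e : OpenPartialHomeomorph V (E × F)}

theorem trans_prodCongr (he : IsSliceChart 𝕜 n S e) (M : E ≃L[𝕜] E') :
    IsSliceChart 𝕜 n S
      (e.transHomeomorph (M.prodCongr (.refl 𝕜 F)).toHomeomorph) where
  contDiffOn := (M.prodCongr (.refl 𝕜 F)).contDiff.comp_contDiffOn he.contDiffOn
  contDiffOn_symm := he.contDiffOn_symm.comp
    (M.prodCongr (.refl 𝕜 F)).symm.contDiff.contDiffOn fun _ hu => hu
  mem_iff := he.mem_iff

theorem symm_mem (he : IsSliceChart 𝕜 n S e) {u : E} (hu : (u, 0) ∈ e.target) :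
    e.symm (u, 0) ∈ S := by
  rw [he.mem_iff _ (e.map_target hu), e.right_inv hu]

theorem fst_apply_zero (he : IsSliceChart 𝕜 n S e) {z : V} (hz : z ∈ e.source) (hS : z ∈ S) :
    ((e z).1, 0) = e z :=
  Prod.ext rfl ((he.mem_iff z hz).1 hS).symm

/-- The chart of `S` induced by a slice chart. The point `z₀` only serves as the value of the
inverse outside its domain. -/
def restrict (he : IsSliceChart 𝕜 n S e) (z₀ : S) : OpenPartialHomeomorph S E where
  toFun z := (e z).1
  invFun u := open Classical in if hu : e.symm (u, 0) ∈ S then ⟨_, hu⟩ else z₀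
  source := Subtype.val ⁻¹' e.source
  target := {u | (u, 0) ∈ e.target}
  map_source' z hz := by
    rw [Set.mem_ofPred_eq, he.fst_apply_zero hz z.2]
    exact e.map_source hz
  map_target' u hu := by
    rw [dif_pos (he.symm_mem hu)]
    exact e.map_target hu
  left_inv' z hz := by
    have h : e.symm ((e z).1, 0) = z := by rw [he.fst_apply_zero hz z.2, e.left_inv hz]
    rw [dif_pos (h.symm ▸ z.2 : e.symm ((e z).1, 0) ∈ S)]
    exact Subtype.ext h
  right_inv' u hu := by
    rw [dif_pos (he.symm_mem hu)]
    exact congrArg Prod.fst (e.right_inv hu)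
  open_source := e.open_source.preimage continuous_subtype_val
  open_target := e.open_target.preimage (by fun_prop)
  continuousOn_toFun := continuous_fst.comp_continuousOn
    (e.continuousOn.comp continuous_subtype_val.continuousOn (Set.mapsTo_preimage _ _))
  continuousOn_invFun := by
    rw [Topology.IsInducing.subtypeVal.continuousOn_iff]
    have h : ContinuousOn (fun u : E => e.symm (u, 0)) {u | (u, 0) ∈ e.target} :=
      e.continuousOn_symm.comp (by fun_prop) fun _ hu => hu
    exact h.congr fun u hu => congrArg Subtype.val (dif_pos (he.symm_mem hu))

theorem coe_restrict_symm (he : IsSliceChart 𝕜 n S e) (z₀ : S) {u : E}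
    (hu : u ∈ (he.restrict z₀).target) : ((he.restrict z₀).symm u : V) = e.symm (u, 0) :=
  congrArg Subtype.val (dif_pos (he.symm_mem hu))

theorem contDiffOn_restrict_symm_trans (he : IsSliceChart 𝕜 n S e)
    {e' : OpenPartialHomeomorph V (E × F)} (he' : IsSliceChart 𝕜 n S e') (z z' : S) :
    ContDiffOn 𝕜 n ((he.restrict z).symm ≫ₕ he'.restrict z')
      ((he.restrict z).symm ≫ₕ he'.restrict z').source := by
  set s := ((he.restrict z).symm ≫ₕ he'.restrict z').source
  have hmaps : Set.MapsTo (fun u : E => e.symm (u, 0)) s e'.source := by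
    intro u hu
    dsimp only
    rw [← he.coe_restrict_symm z hu.1]
    exact hu.2
  have hsymm : ContDiffOn 𝕜 n (fun u : E => e.symm (u, 0)) s :=
    he.contDiffOn_symm.comp (by fun_prop) fun u hu => hu.1
  refine (contDiff_fst.comp_contDiffOn (he'.contDiffOn.comp hsymm hmaps)).congr fun u hu => ?_
  exact congrArg (fun w => (e' w).1) (he.coe_restrict_symm z hu.1)

theorem transHomeomorph_mem_maximalAtlas (he : IsSliceChart 𝕜 n S e) (L : (E × F) ≃L[𝕜] V) :
    e.transHomeomorph L.toHomeomorph ∈ IsManifold.maximalAtlas 𝓘(𝕜, V) n V := by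
  refine StructureGroupoid.mem_maximalAtlas_of_mem_groupoid _ ?_
  rw [contDiffGroupoid, mem_groupoid_of_pregroupoid]
  simpa [contDiffPregroupoid] using
    ⟨L.contDiff.comp_contDiffOn he.contDiffOn,
      he.contDiffOn_symm.comp L.symm.contDiff.contDiffOn fun _ hu => hu⟩

end IsSliceChart

variable (𝕜 n E F) in
/-- `S` is an embedded `C^n` submanifold modelled on `E`, of codimension modelled on `F`, in the
sense of the local slice condition. -/
def HasSliceCharts (S : Set V) : Prop :=
  ∀ z ∈ S, ∃ e : OpenPartialHomeomorph V (E × F), z ∈ e.source ∧ IsSliceChart 𝕜 n S e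

namespace HasSliceCharts

theorem congr (h : HasSliceCharts 𝕜 n E F S) (M : E ≃L[𝕜] E') : HasSliceCharts 𝕜 n E' F S :=
  fun z hz => let ⟨_, hze, he⟩ := h z hz; ⟨_, hze, he.trans_prodCongr M⟩

/-- The charted space structure on `S` whose atlas consists of the restrictions of all slice
charts. -/
@[reducible] def chartedSpace (h : HasSliceCharts 𝕜 n E F S) : ChartedSpace E S where
  atlas := {c | ∃ (e : OpenPartialHomeomorph V (E × F)) (he : IsSliceChart 𝕜 n S e) (z₀ : S),
    c = he.restrict z₀}
  chartAt z := (h z z.2).choose_spec.2.restrict z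
  mem_chart_source z := (h z z.2).choose_spec.1
  chart_mem_atlas _ := ⟨_, _, _, rfl⟩

theorem isManifold (h : HasSliceCharts 𝕜 n E F S) :
    letI := h.chartedSpace
    IsManifold 𝓘(𝕜, E) n S := by
  let _ := h.chartedSpace
  refine isManifold_of_contDiffOn _ _ _ ?_
  rintro _ _ ⟨e, he, z, rfl⟩ ⟨e', he', z', rfl⟩
  simpa using he.contDiffOn_restrict_symm_trans he' z z'

theorem isSmoothEmbedding (h : HasSliceCharts 𝕜 n E F S) (L : (E × F) ≃L[𝕜] V) :
    letI := h.chartedSpace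
    Manifold.IsSmoothEmbedding 𝓘(𝕜, E) 𝓘(𝕜, V) n (Subtype.val : S → V) := by
  let _ := h.chartedSpace
  have := h.isManifold
  refine ⟨Manifold.IsImmersionOfComplement.isImmersion (F := F) fun z => ?_, .subtypeVal⟩
  obtain ⟨hz, he⟩ := (h z z.2).choose_spec
  refine .mk_of_continuousAt continuous_subtype_val.continuousAt L (he.restrict z) _ hz hz
    (IsManifold.chart_mem_maximalAtlas z) (he.transHomeomorph_mem_maximalAtlas L) fun u hu => ?_
  have hu' : u ∈ (he.restrict z).target := by simpa using hu
  refine congrArg L ?_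
  change (h z z.2).choose ((he.restrict z).symm u : V) = (u, 0)
  rw [he.coe_restrict_symm z hu']
  exact (h z z.2).choose.right_inv hu'

end HasSliceCharts

end Slices

section DotProduct

open Complex

variable {ι : Type*}

theorem re_comp_add_I_smul (x y : ι → ℝ) : re ∘ (ofReal ∘ x + I • (ofReal ∘ y)) = x :=
  funext fun i => by simp

theorem im_comp_add_I_smul (x y : ι → ℝ) : im ∘ (ofReal ∘ x + I • (ofReal ∘ y)) = y :=
  funext fun i => by simp

variable [Fintype ι] {x y : ι → ℝ}

/-- The coefficient of the orthogonal projection of `f` to the line spanned by `x`. -/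
def projCoeff (x f : ι → ℝ) : ℝ := f ⬝ᵥ x / (x ⬝ᵥ x)

theorem projCoeff_add_smul (hx : x ⬝ᵥ x ≠ 0) (hy : y ⬝ᵥ x = 0) (a : ℝ) :
    projCoeff x (y + a • x) = a := by
  rw [projCoeff, add_dotProduct, hy, zero_add, smul_dotProduct, smul_eq_mul,
    mul_div_cancel_right₀ _ hx]

theorem sub_projCoeff_smul_dotProduct (hx : x ⬝ᵥ x ≠ 0) (f : ι → ℝ) :
    (f - projCoeff x f • x) ⬝ᵥ x = 0 := by
  rw [projCoeff, sub_dotProduct, smul_dotProduct, smul_eq_mul, div_mul_cancel₀ _ hx, sub_self]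

/-- The Gram determinant of `f` and `x`: the squared distance of `f` to the line spanned by `x`,
multiplied by `x ⬝ᵥ x` to make it a polynomial. -/
def gramDet (x f : ι → ℝ) : ℝ := (f ⬝ᵥ f) * (x ⬝ᵥ x) - (f ⬝ᵥ x) ^ 2

theorem gramDet_add_smul (hy : y ⬝ᵥ x = 0) (a : ℝ) :
    gramDet x (y + a • x) = (y ⬝ᵥ y) * (x ⬝ᵥ x) := by
  simp only [gramDet, add_dotProduct, dotProduct_add, smul_dotProduct, dotProduct_smul, smul_eq_mul,
    dotProduct_comm x y, hy]
  ring

theorem re_dotProduct_self (w : ι → ℂ) :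
    (w ⬝ᵥ w).re = re ∘ w ⬝ᵥ re ∘ w - im ∘ w ⬝ᵥ im ∘ w := by
  simp [dotProduct, Finset.sum_sub_distrib]

theorem im_dotProduct_self (w : ι → ℂ) :
    (w ⬝ᵥ w).im = 2 * (im ∘ w ⬝ᵥ re ∘ w) := by
  rw [dotProduct, dotProduct, im_sum, Finset.mul_sum]
  refine Finset.sum_congr rfl fun i _ => ?_
  rw [mul_im, Function.comp_apply, Function.comp_apply]
  ring

theorem add_I_smul_dotProduct_self (h : y ⬝ᵥ x = 0) :
    (ofReal ∘ x + I • (ofReal ∘ y)) ⬝ᵥ (ofReal ∘ x + I • (ofReal ∘ y)) =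
      ((x ⬝ᵥ x - y ⬝ᵥ y : ℝ) : ℂ) := by
  apply Complex.ext
  · rw [re_dotProduct_self, re_comp_add_I_smul, im_comp_add_I_smul, ofReal_re]
  · rw [im_dotProduct_self, re_comp_add_I_smul, im_comp_add_I_smul, h, mul_zero, ofReal_im]

end DotProduct

section PolarChart

open Complex

variable {k : ℕ}

theorem rotatedSegment_eq_cons (X : Fin k → ℝ) (θ : ℝ) :
    rotatedSegment (k + 1) X θ = Fin.cons 0 (exp (θ * I) • (ofReal ∘ X)) := by
  funext j
  cases j using Fin.cases <;> simp [rotatedSegment]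

theorem rotatedSegment_neg_add_pi (X : Fin k → ℝ) (θ : ℝ) :
    rotatedSegment (k + 1) (-X) (θ + Real.pi) = rotatedSegment (k + 1) X θ := by
  have hexp : exp (↑(θ + Real.pi) * I) = -exp (θ * I) := by
    rw [ofReal_add, add_mul, exp_add, exp_pi_mul_I, mul_neg_one]
  rw [rotatedSegment_eq_cons, rotatedSegment_eq_cons, hexp]
  congr 1
  funext j
  simp

theorem contDiff_rotatedSegment {m : ℕ∞ω} :
    ContDiff ℝ m fun u : (Fin k → ℝ) × ℝ => rotatedSegment (k + 1) u.1 u.2 := by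
  simp only [rotatedSegment_eq_cons]
  refine contDiff_pi.2 fun j => ?_
  cases j using Fin.cases with
  | zero => exact contDiff_const
  | succ j =>
    simp only [Fin.cons_succ, Pi.smul_apply, Function.comp_apply, smul_eq_mul]
    exact ((ofRealCLM.contDiff.comp contDiff_snd).mul contDiff_const).cexp.mul
      (ofRealCLM.contDiff.comp (by fun_prop))

theorem rotatedSegment_mem_pointedSegments {X : Fin k → ℝ} (hX : X ≠ 0) (θ : ℝ) :
    rotatedSegment (k + 1) X θ ∈ pointedSegments (k + 1) := by
  obtain ⟨j, hj⟩ := Function.ne_iff.1 hX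
  rw [rotatedSegment_eq_cons]
  refine ⟨⟨?_, j.succ, 0, by simpa using hj⟩, fun i hi => ?_⟩
  · refine (collinear_iff_of_mem (Set.mem_range_self 0)).2 ⟨exp (θ * I), ?_⟩
    rintro _ ⟨i, rfl⟩
    cases i using Fin.cases with
    | zero => exact ⟨0, by simp⟩
    | succ i => exact ⟨X i, by simp [mul_comm]⟩
  · obtain rfl : i = 0 := Fin.ext hi
    rfl

theorem mem_pointedSegments_iff {Z : Fin (k + 1) → ℂ} :
    Z ∈ pointedSegments (k + 1) ↔ ∃ X ≠ 0, ∃ θ, rotatedSegment (k + 1) X θ = Z := by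
  refine ⟨?_, fun ⟨X, hX, θ, h⟩ => h ▸ rotatedSegment_mem_pointedSegments hX θ⟩
  rintro ⟨⟨hline, i, j, hij⟩, hzero⟩
  have hZ : Z 0 = 0 := hzero 0 rfl
  obtain ⟨v, hv⟩ := (collinear_iff_of_mem (Set.mem_range_self 0)).1 hline
  choose r hr using fun i => hv (Z i) (Set.mem_range_self i)
  have hrot : rotatedSegment (k + 1) (fun i => r i.succ * ‖v‖) v.arg = Z := by
    rw [rotatedSegment_eq_cons]
    funext i
    cases i using Fin.cases with
    | zero => exact hZ.symm
    | succ i =>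
      rw [hr i.succ, hZ, vadd_eq_add, add_zero, real_smul]
      nth_rewrite 3 [← norm_mul_exp_arg_mul_I v]
      simp [mul_comm, mul_left_comm]
  refine ⟨_, fun h => hij ?_, _, hrot⟩
  rw [← hrot, h]
  simp [rotatedSegment]

/-- The number `e^{-2iα} ∑ⱼ Zⱼ²`, with the sum over the vertices other than the first one. At
`Z = (0, e^{iθ} X)` its argument is `2 (θ - α)` modulo `2π`. -/
def phase (α : ℝ) (Z : Fin (k + 1) → ℂ) : ℂ :=
  exp (-(2 * α) * I) * (Fin.tail Z ⬝ᵥ Fin.tail Z)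

/-- The open set of tuples with a well-defined direction in `(α - π / 2, α + π / 2)`. -/
def polarDomain (k : ℕ) (α : ℝ) : Set (Fin (k + 1) → ℂ) := phase α ⁻¹' slitPlane

/-- The direction `θ ∈ (α - π / 2, α + π / 2)` of a tuple `Z`, determined by
`∑ⱼ Zⱼ² ∈ e^{2iθ} ℝ_{> 0}`. -/
def polarAngle (α : ℝ) (Z : Fin (k + 1) → ℂ) : ℝ := α + (phase α Z).arg / 2

/-- The vertices of `Z` other than the first one, rotated back by the direction of `Z`. -/
def derotation (α : ℝ) (Z : Fin (k + 1) → ℂ) : Fin k → ℂ :=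
  exp (-polarAngle α Z * I) • Fin.tail Z

variable {α : ℝ}

theorem phase_cons (c : ℂ) (θ : ℝ) {w : Fin k → ℂ} {r : ℝ} (hw : w ⬝ᵥ w = r) :
    phase α (Fin.cons c (exp (θ * I) • w)) = r * exp (↑(2 * (θ - α)) * I) := by
  rw [phase, Fin.tail_cons, smul_dotProduct, dotProduct_smul, hw, smul_eq_mul, smul_eq_mul,
    ← mul_assoc, ← mul_assoc, ← exp_add, ← exp_add, mul_comm]
  congr 2
  push_cast
  ring

theorem cons_mem_polarDomain_iff (c : ℂ) {θ : ℝ} {w : Fin k → ℂ} {r : ℝ} (hr : 0 < r)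
    (hw : w ⬝ᵥ w = r) :
    Fin.cons c (exp (θ * I) • w) ∈ polarDomain k α ↔ Real.cos (θ - α) ≠ 0 := by
  have hre : (phase α (Fin.cons c (exp (θ * I) • w) : Fin (k + 1) → ℂ)).re =
      r * (Real.cos (θ - α) ^ 2 - Real.sin (θ - α) ^ 2) := by
    rw [phase_cons c θ hw, re_ofReal_mul, exp_ofReal_mul_I_re, Real.cos_two_mul']
  have him : (phase α (Fin.cons c (exp (θ * I) • w) : Fin (k + 1) → ℂ)).im =
      r * (2 * Real.sin (θ - α) * Real.cos (θ - α)) := by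
    rw [phase_cons c θ hw, im_ofReal_mul, exp_ofReal_mul_I_im, Real.sin_two_mul]
  rw [polarDomain, Set.mem_preimage, mem_slitPlane_iff, hre, him]
  refine ⟨fun h hcos => ?_, fun hcos => ?_⟩
  · have : 0 < -(r * Real.sin (θ - α) ^ 2) := by simpa [hcos] using h
    linarith [mul_nonneg hr.le (sq_nonneg (Real.sin (θ - α)))]
  · by_cases hsin : Real.sin (θ - α) = 0
    · left
      rw [hsin]
      simpa using by positivity
    · right
      positivity

theorem polarAngle_cons (c : ℂ) {θ : ℝ} {w : Fin k → ℂ} {r : ℝ} (hr : 0 < r)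
    (hw : w ⬝ᵥ w = r) (hθ : |θ - α| < Real.pi / 2) :
    polarAngle α (Fin.cons c (exp (θ * I) • w) : Fin (k + 1) → ℂ) = θ := by
  obtain ⟨h₁, h₂⟩ := abs_lt.1 hθ
  rw [polarAngle, phase_cons c θ hw, exp_mul_I,
    arg_mul_cos_add_sin_mul_I hr ⟨by linarith, by linarith⟩]
  ring

theorem derotation_cons (c : ℂ) {θ : ℝ} {w : Fin k → ℂ} {r : ℝ} (hr : 0 < r)
    (hw : w ⬝ᵥ w = r) (hθ : |θ - α| < Real.pi / 2) :
    derotation α (Fin.cons c (exp (θ * I) • w) : Fin (k + 1) → ℂ) = w := by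
  rw [derotation, polarAngle_cons c hr hw hθ, Fin.tail_cons, smul_smul, ← exp_add]
  simp

theorem exp_smul_derotation (α : ℝ) (Z : Fin (k + 1) → ℂ) :
    exp (polarAngle α Z * I) • derotation α Z = Fin.tail Z := by
  rw [derotation, smul_smul, ← exp_add]
  simp

theorem derotation_dotProduct_self (α : ℝ) (Z : Fin (k + 1) → ℂ) :
    derotation α Z ⬝ᵥ derotation α Z = ‖phase α Z‖ := by
  have hexp : exp (-polarAngle α Z * I) * exp (-polarAngle α Z * I) =
      exp (-((phase α Z).arg * I)) * exp (-(2 * α) * I) := by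
    rw [← exp_add, ← exp_add, polarAngle]
    congr 1
    push_cast
    ring
  calc derotation α Z ⬝ᵥ derotation α Z
      = exp (-polarAngle α Z * I) * exp (-polarAngle α Z * I) * (Fin.tail Z ⬝ᵥ Fin.tail Z) := by
        rw [derotation, smul_dotProduct, dotProduct_smul, smul_eq_mul, smul_eq_mul, mul_assoc]
    _ = exp (-((phase α Z).arg * I)) * phase α Z := by rw [hexp, mul_assoc, phase]
    _ = ‖phase α Z‖ := by
        nth_rewrite 2 [← norm_mul_exp_arg_mul_I (phase α Z)]
        rw [mul_left_comm, ← exp_add, neg_add_cancel, exp_zero, mul_one]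

theorem abs_polarAngle_sub_lt {Z : Fin (k + 1) → ℂ} (hZ : Z ∈ polarDomain k α) :
    |polarAngle α Z - α| < Real.pi / 2 := by
  have harg : |(phase α Z).arg| < Real.pi :=
    abs_lt.2 ⟨neg_pi_lt_arg _, (arg_le_pi _).lt_of_ne (mem_slitPlane_iff_arg.1 hZ).1⟩
  rw [polarAngle, add_sub_cancel_left, abs_div, abs_two]
  linarith

theorem isOpen_polarDomain (k : ℕ) (α : ℝ) : IsOpen (polarDomain k α) := by
  refine isOpen_slitPlane.preimage ?_
  unfold phase dotProduct Fin.tail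
  fun_prop

theorem contDiff_phase {m : ℕ∞ω} : ContDiff ℝ m (phase α : (Fin (k + 1) → ℂ) → ℂ) := by
  unfold phase dotProduct Fin.tail
  fun_prop

theorem contDiffOn_polarAngle {m : ℕ∞ω} : ContDiffOn ℝ m (polarAngle α) (polarDomain k α) := by
  intro Z hZ
  have hlog : ContDiffAt ℝ m (fun Z => log (phase α Z)) Z :=
    ((contDiffAt_log hZ).restrict_scalars ℝ).comp Z contDiff_phase.contDiffAt
  have harg : ContDiffAt ℝ m (fun Z => (phase α Z).arg) Z := by
    simpa only [Function.comp_def, imCLM_apply, log_im] using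
      imCLM.contDiff.contDiffAt.comp Z hlog
  exact (contDiffAt_const.add (harg.div_const 2)).contDiffWithinAt

theorem contDiffOn_derotation {m : ℕ∞ω} : ContDiffOn ℝ m (derotation α) (polarDomain k α) := by
  have hexp : ContDiffOn ℝ m (fun Z => exp (-polarAngle α Z * I)) (polarDomain k α) :=
    ((ofRealCLM.contDiff.comp_contDiffOn contDiffOn_polarAngle).neg.mul contDiffOn_const).cexp
  refine hexp.smul ?_
  unfold Fin.tail
  fun_prop

/-- The vector `x + i y`, where `y ⊥ x` is given by `f = y + a x`. -/
def polarVector (x f : Fin k → ℝ) : Fin k → ℂ :=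
  ofReal ∘ x + I • (ofReal ∘ (f - projCoeff x f • x))

/-- The inverse of `polarChart α`: it sends `((x, θ), (f, b))` to `(a + b i, e^{iθ} (x + i y))`,
where `a` and `y ⊥ x` are given by `f = y + a x`. -/
def polarPoint (u : ((Fin k → ℝ) × ℝ) × ((Fin k → ℝ) × ℝ)) : Fin (k + 1) → ℂ :=
  Fin.cons (projCoeff u.1.1 u.2.1 + u.2.2 * I) (exp (u.1.2 * I) • polarVector u.1.1 u.2.1)

/-- The polar coordinates `((x, θ), (f, b))` of a tuple: see `polarPoint`. -/
def polarCoords (α : ℝ) (Z : Fin (k + 1) → ℂ) : ((Fin k → ℝ) × ℝ) × ((Fin k → ℝ) × ℝ) :=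
  ((re ∘ derotation α Z, polarAngle α Z),
    (im ∘ derotation α Z + (Z 0).re • (re ∘ derotation α Z), (Z 0).im))

/-- The image of `polarChart α`. The second condition says `x ≠ 0` and `|y| < |x|` in the notation
of `polarPoint`. -/
def polarTarget (k : ℕ) (α : ℝ) : Set (((Fin k → ℝ) × ℝ) × ((Fin k → ℝ) × ℝ)) :=
  {u | |u.1.2 - α| < Real.pi / 2 ∧ gramDet u.1.1 u.2.1 < (u.1.1 ⬝ᵥ u.1.1) ^ 2}

theorem isOpen_polarTarget (k : ℕ) (α : ℝ) : IsOpen (polarTarget k α) := by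
  unfold polarTarget gramDet dotProduct
  exact (isOpen_lt (by fun_prop) (by fun_prop)).and (isOpen_lt (by fun_prop) (by fun_prop))

theorem mem_polarTarget_zero_iff {X : Fin k → ℝ} {θ : ℝ} :
    ((X, θ), 0) ∈ polarTarget k α ↔ |θ - α| < Real.pi / 2 ∧ X ≠ 0 := by
  simp [polarTarget, gramDet, sq_pos_iff]

theorem polarPoint_zero (X : Fin k → ℝ) (θ : ℝ) :
    polarPoint ((X, θ), 0) = rotatedSegment (k + 1) X θ := by
  simp [polarPoint, polarVector, projCoeff, rotatedSegment_eq_cons]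

section Target

variable {u : ((Fin k → ℝ) × ℝ) × ((Fin k → ℝ) × ℝ)} (hu : u ∈ polarTarget k α)

include hu

theorem dotProduct_self_pos_of_mem_polarTarget : 0 < u.1.1 ⬝ᵥ u.1.1 := by
  refine Matrix.dotProduct_self_star_pos_iff.2 fun h => ?_
  simpa [h, gramDet] using hu.2

theorem exists_polarVector_dotProduct_self_eq :
    ∃ r : ℝ, 0 < r ∧ polarVector u.1.1 u.2.1 ⬝ᵥ polarVector u.1.1 u.2.1 = r := by
  have hpos := dotProduct_self_pos_of_mem_polarTarget hu
  have horth := sub_projCoeff_smul_dotProduct hpos.ne' u.2.1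
  have hgram := hu.2
  rw [← sub_add_cancel u.2.1 (projCoeff u.1.1 u.2.1 • u.1.1), gramDet_add_smul horth, sq] at hgram
  exact ⟨_, sub_pos.2 (lt_of_mul_lt_mul_right hgram hpos.le), add_I_smul_dotProduct_self horth⟩

theorem polarPoint_mem_polarDomain : polarPoint u ∈ polarDomain k α := by
  obtain ⟨r, hr, hw⟩ := exists_polarVector_dotProduct_self_eq hu
  exact (cons_mem_polarDomain_iff _ hr hw).2 (Real.cos_pos_of_mem_Ioo (abs_lt.1 hu.1)).ne'

theorem polarCoords_polarPoint : polarCoords α (polarPoint u) = u := by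
  obtain ⟨r, hr, hw⟩ := exists_polarVector_dotProduct_self_eq hu
  rw [polarCoords, polarPoint, derotation_cons _ hr hw hu.1, polarAngle_cons _ hr hw hu.1,
    polarVector, re_comp_add_I_smul, im_comp_add_I_smul]
  simp

end Target

section Domain

variable {Z : Fin (k + 1) → ℂ}

theorem im_derotation_dotProduct_re (α : ℝ) (Z : Fin (k + 1) → ℂ) :
    im ∘ derotation α Z ⬝ᵥ re ∘ derotation α Z = 0 := by
  have h := im_dotProduct_self (derotation α Z)
  rw [derotation_dotProduct_self, ofReal_im] at h
  linarith

theorem im_derotation_dotProduct_self_lt (hZ : Z ∈ polarDomain k α) :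
    im ∘ derotation α Z ⬝ᵥ im ∘ derotation α Z < re ∘ derotation α Z ⬝ᵥ re ∘ derotation α Z := by
  have h := re_dotProduct_self (derotation α Z)
  rw [derotation_dotProduct_self, ofReal_re] at h
  linarith [norm_pos_iff.2 (slitPlane_ne_zero hZ)]

theorem re_derotation_dotProduct_self_pos (hZ : Z ∈ polarDomain k α) :
    0 < re ∘ derotation α Z ⬝ᵥ re ∘ derotation α Z :=
  (dotProduct_self_star_nonneg (im ∘ derotation α Z)).trans_lt
    (im_derotation_dotProduct_self_lt hZ)

theorem polarCoords_mem_polarTarget (hZ : Z ∈ polarDomain k α) :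
    polarCoords α Z ∈ polarTarget k α := by
  refine ⟨abs_polarAngle_sub_lt hZ, ?_⟩
  rw [polarCoords, gramDet_add_smul (im_derotation_dotProduct_re α Z), sq]
  exact mul_lt_mul_of_pos_right (im_derotation_dotProduct_self_lt hZ)
    (re_derotation_dotProduct_self_pos hZ)

theorem polarPoint_polarCoords (hZ : Z ∈ polarDomain k α) : polarPoint (polarCoords α Z) = Z := by
  have hproj := projCoeff_add_smul (re_derotation_dotProduct_self_pos hZ).ne'
    (im_derotation_dotProduct_re α Z) (Z 0).re
  have hw : ofReal ∘ re ∘ derotation α Z + I • (ofReal ∘ im ∘ derotation α Z) =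
      derotation α Z := by
    funext i
    simp [mul_comm I]
  rw [polarPoint, polarCoords, polarVector]
  dsimp only
  rw [hproj, add_sub_cancel_right, hw, exp_smul_derotation, re_add_im]
  exact Fin.cons_self_tail Z

end Domain

theorem contDiffOn_polarCoords {m : ℕ∞ω} : ContDiffOn ℝ m (polarCoords α) (polarDomain k α) := by
  have hre : ContDiffOn ℝ m (fun Z => re ∘ derotation α Z) (polarDomain k α) :=
    contDiffOn_pi.2 fun i =>
      reCLM.contDiff.comp_contDiffOn (contDiffOn_pi.1 contDiffOn_derotation i)
  have him : ContDiffOn ℝ m (fun Z => im ∘ derotation α Z) (polarDomain k α) :=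
    contDiffOn_pi.2 fun i =>
      imCLM.contDiff.comp_contDiffOn (contDiffOn_pi.1 contDiffOn_derotation i)
  have hre₀ : ContDiff ℝ m fun Z : Fin (k + 1) → ℂ => (Z 0).re := reCLM.contDiff.comp (by fun_prop)
  have him₀ : ContDiff ℝ m fun Z : Fin (k + 1) → ℂ => (Z 0).im := imCLM.contDiff.comp (by fun_prop)
  exact (hre.prodMk contDiffOn_polarAngle).prodMk
    ((him.add (hre₀.contDiffOn.smul hre)).prodMk him₀.contDiffOn)

theorem contDiffOn_polarPoint {m : ℕ∞ω} : ContDiffOn ℝ m polarPoint (polarTarget k α) := by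
  have hproj : ContDiffOn ℝ m
      (fun u : ((Fin k → ℝ) × ℝ) × ((Fin k → ℝ) × ℝ) => projCoeff u.1.1 u.2.1)
      (polarTarget k α) := by
    refine ContDiffOn.div ?_ ?_ fun u hu => (dotProduct_self_pos_of_mem_polarTarget hu).ne'
    all_goals
      unfold dotProduct
      fun_prop
  have hcast {g : ((Fin k → ℝ) × ℝ) × ((Fin k → ℝ) × ℝ) → ℝ}
      (hg : ContDiffOn ℝ m g (polarTarget k α)) :
      ContDiffOn ℝ m (fun u => (g u : ℂ)) (polarTarget k α) := ofRealCLM.contDiff.comp_contDiffOn hg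
  refine contDiffOn_pi.2 fun j => ?_
  cases j using Fin.cases with
  | zero => exact (hcast hproj).add ((hcast (by fun_prop)).mul contDiffOn_const)
  | succ j =>
    refine ((hcast (by fun_prop)).mul contDiffOn_const).cexp.mul ((hcast ?_).add
      (contDiffOn_const.mul (hcast (ContDiffOn.sub ?_ (hproj.mul ?_)))))
    all_goals fun_prop

/-- Polar coordinates on the tuples with a direction `θ` in `(α - π / 2, α + π / 2)`. They form a
slice chart for the set of pointed segments. -/
def polarChart (k : ℕ) (α : ℝ) :
    OpenPartialHomeomorph (Fin (k + 1) → ℂ) (((Fin k → ℝ) × ℝ) × ((Fin k → ℝ) × ℝ)) where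
  toFun := polarCoords α
  invFun := polarPoint
  source := polarDomain k α
  target := polarTarget k α
  map_source' _ := polarCoords_mem_polarTarget
  map_target' _ := polarPoint_mem_polarDomain
  left_inv' _ := polarPoint_polarCoords
  right_inv' _ := polarCoords_polarPoint
  open_source := isOpen_polarDomain k α
  open_target := isOpen_polarTarget k α
  continuousOn_toFun := (contDiffOn_polarCoords (m := 0)).continuousOn
  continuousOn_invFun := (contDiffOn_polarPoint (m := 0)).continuousOn

theorem rotatedSegment_mem_polarDomain_iff {X : Fin k → ℝ} (hX : X ≠ 0) {θ : ℝ} :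
    rotatedSegment (k + 1) X θ ∈ polarDomain k α ↔ Real.cos (θ - α) ≠ 0 := by
  rw [rotatedSegment_eq_cons]
  exact cons_mem_polarDomain_iff 0 (Matrix.dotProduct_self_star_pos_iff.2 hX) (by simp [dotProduct])

theorem im_comp_derotation_rotatedSegment {X : Fin k → ℝ} {θ : ℝ}
    (h : rotatedSegment (k + 1) X θ ∈ polarDomain k α) :
    im ∘ derotation α (rotatedSegment (k + 1) X θ) = 0 := by
  have horth := im_derotation_dotProduct_re α (rotatedSegment (k + 1) X θ)
  have hpos := re_derotation_dotProduct_self_pos h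
  obtain ⟨c, hc⟩ : ∃ c : ℂ, derotation α (rotatedSegment (k + 1) X θ) = c • (ofReal ∘ X) :=
    ⟨_, by rw [derotation, rotatedSegment_eq_cons, Fin.tail_cons, smul_smul]⟩
  have hre : re ∘ (c • (ofReal ∘ X)) = c.re • X := funext fun i => by simp
  have him : im ∘ (c • (ofReal ∘ X)) = c.im • X := funext fun i => by simp
  rw [hc, hre, smul_dotProduct] at hpos
  rw [hc, hre, him, smul_dotProduct] at horth
  have hX : X ⬝ᵥ c.re • X ≠ 0 := right_ne_zero_of_mul hpos.ne'
  rw [hc, him, (smul_eq_zero.1 horth).resolve_right hX, zero_smul]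

theorem isSliceChart_polarChart (k : ℕ) (α : ℝ) :
    IsSliceChart ℝ ∞ (pointedSegments (k + 1)) (polarChart k α) where
  contDiffOn := contDiffOn_polarCoords
  contDiffOn_symm := contDiffOn_polarPoint
  mem_iff Z hZ := by
    refine ⟨fun h => ?_, fun h => ?_⟩
    · obtain ⟨X, -, θ, rfl⟩ := mem_pointedSegments_iff.1 h
      change (_, _) = 0
      rw [im_comp_derotation_rotatedSegment hZ, rotatedSegment_eq_cons]
      simp
    · obtain ⟨⟨⟨X, θ⟩, v⟩, hu⟩ : ∃ u, u = polarChart k α Z := ⟨_, rfl⟩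
      have hv : v = 0 := by rwa [← hu] at h
      subst hv
      have hX : X ≠ 0 :=
        (mem_polarTarget_zero_iff.1 (hu ▸ (polarChart k α).map_source hZ)).2
      rw [← (polarChart k α).left_inv hZ, ← hu]
      change polarPoint ((X, θ), 0) ∈ _
      rw [polarPoint_zero]
      exact rotatedSegment_mem_pointedSegments hX θ

theorem hasSliceCharts_pointedSegments (k : ℕ) :
    HasSliceCharts ℝ ∞ ((Fin k → ℝ) × ℝ) ((Fin k → ℝ) × ℝ) (pointedSegments (k + 1)) := by
  intro Z hZ
  obtain ⟨X, hX, θ, rfl⟩ := mem_pointedSegments_iff.1 hZ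
  exact ⟨polarChart k θ, (rotatedSegment_mem_polarDomain_iff hX).2 (by simp),
    isSliceChart_polarChart k θ⟩

end PolarChart

namespace PuncturedTorus

variable {k : ℕ}

/-- The map `[X, θ] ↦ (0, e^{iθ} X)`. -/
def toSegments : PuncturedTorus k → pointedSegments (k + 1) :=
  Quot.lift (fun x => ⟨rotatedSegment (k + 1) x.1.1 x.2,
    rotatedSegment_mem_pointedSegments x.1.2 x.2⟩) (by
    rintro x y ⟨hx, hy, h⟩
    refine Subtype.ext ?_
    dsimp only
    rw [hx, hy, h, ← rotatedSegment_neg_add_pi, zero_add])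

theorem continuous_toSegments : Continuous (toSegments (k := k)) := by
  refine continuous_quot_lift _ (Continuous.subtype_mk ?_ _)
  exact (contDiff_rotatedSegment (m := 0)).continuous.comp
    (f := fun x : PuncturedSpace k × Set.Icc (0 : ℝ) Real.pi => (x.1.1, (x.2 : ℝ))) (by fun_prop)

theorem coe_toSegments_mk (x : PuncturedSpace k × Set.Icc (0 : ℝ) Real.pi) :
    (toSegments (mk x) : Fin (k + 1) → ℂ) = rotatedSegment (k + 1) x.1.1 x.2 := rfl

theorem coe_toSegments_point (p : PuncturedTorus k) {X : Fin k → ℝ} (hX : X ≠ 0) {θ : ℝ}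
    (hθ : θ ∈ Set.Icc 0 Real.pi) :
    (toSegments (point p X θ) : Fin (k + 1) → ℂ) = rotatedSegment (k + 1) X θ :=
  (congrArg (fun q => (toSegments q : Fin (k + 1) → ℂ)) (point_eq p (⟨X, hX⟩, ⟨θ, hθ⟩))).trans
    (coe_toSegments_mk _)

/-- `e` is a chart of the torus in which `toSegments` reads as `(X, θ) ↦ (0, e^{iθ} X)`, with `θ`
ranging over `(α - π / 2, α + π / 2)`. -/
structure IsPolarChart (α : ℝ) (e : OpenPartialHomeomorph (PuncturedTorus k) ((Fin k → ℝ) × ℝ)) :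
    Prop where
  mem_maximalAtlas : e ∈ IsManifold.maximalAtlas 𝓘(ℝ, (Fin k → ℝ) × ℝ) ∞ (PuncturedTorus k)
  mem_target_iff : ∀ u, u ∈ e.target ↔ (u, 0) ∈ polarTarget k α
  mem_source : ∀ p, (toSegments p : Fin (k + 1) → ℂ) ∈ polarDomain k α → p ∈ e.source
  coe_toSegments_symm : ∀ u ∈ e.target,
    (toSegments (e.symm u) : Fin (k + 1) → ℂ) = rotatedSegment (k + 1) u.1 u.2

theorem isPolarChart_chartA (p : PuncturedTorus k) : IsPolarChart (Real.pi / 2) (chartA p) where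
  mem_maximalAtlas := IsManifold.subset_maximalAtlas (Or.inl ⟨p, rfl⟩)
  mem_target_iff := by
    rintro ⟨X, θ⟩
    rw [mem_polarTarget_zero_iff, and_comm, abs_lt, neg_lt_sub_iff_lt_add, sub_lt_iff_lt_add,
      add_halves, lt_add_iff_pos_right]
    rfl
  mem_source q hq := by
    obtain ⟨⟨X, θ⟩, rfl⟩ : ∃ x, mk x = q := Quot.exists_rep q
    rw [coe_toSegments_mk, rotatedSegment_mem_polarDomain_iff X.2, Real.cos_sub_pi_div_two] at hq
    refine (coordA_mem_iff (X, θ)).2 ⟨θ.2.1.lt_of_ne' fun h => hq ?_, θ.2.2.lt_of_ne fun h => hq ?_⟩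
    · exact (congrArg Real.sin h).trans Real.sin_zero
    · exact (congrArg Real.sin h).trans Real.sin_pi
  coe_toSegments_symm _ hu := coe_toSegments_point p hu.1 ⟨hu.2.1.le, hu.2.2.le⟩

theorem isPolarChart_chartB (p : PuncturedTorus k) : IsPolarChart 0 (chartB p) where
  mem_maximalAtlas := IsManifold.subset_maximalAtlas (Or.inr ⟨p, rfl⟩)
  mem_target_iff := by
    rintro ⟨X, θ⟩
    rw [mem_polarTarget_zero_iff, and_comm, sub_zero, abs_lt]
    rfl
  mem_source q hq := by
    obtain ⟨⟨X, θ⟩, rfl⟩ : ∃ x, mk x = q := Quot.exists_rep q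
    rw [coe_toSegments_mk, rotatedSegment_mem_polarDomain_iff X.2, sub_zero] at hq
    exact (coordB_mem_iff (X, θ)).2 fun h => hq ((congrArg Real.cos h).trans Real.cos_pi_div_two)
  coe_toSegments_symm := by
    rintro ⟨X, θ⟩ ⟨hX, hθ₁, hθ₂⟩
    dsimp only at hX hθ₁ hθ₂
    change (toSegments (pointB p X θ) : Fin (k + 1) → ℂ) = _
    unfold pointB
    split_ifs with h
    · exact coe_toSegments_point p hX ⟨h, by linarith [Real.pi_pos]⟩
    · rw [coe_toSegments_point p (neg_ne_zero.2 hX) ⟨by linarith, by linarith [Real.pi_pos]⟩,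
        rotatedSegment_neg_add_pi]

theorem exists_isPolarChart (Z : pointedSegments (k + 1)) :
    ∃ α, Z.1 ∈ polarDomain k α ∧
      ∃ e : OpenPartialHomeomorph (PuncturedTorus k) ((Fin k → ℝ) × ℝ), IsPolarChart α e := by
  obtain ⟨Z, hZ⟩ := Z
  obtain ⟨X, hX, θ, rfl⟩ := mem_pointedSegments_iff.1 hZ
  let p : PuncturedTorus k := mk (⟨X, hX⟩, ⟨0, le_rfl, Real.pi_pos.le⟩)
  by_cases hcos : Real.cos θ = 0
  · refine ⟨_, (rotatedSegment_mem_polarDomain_iff hX).2 fun hsin => ?_, _, isPolarChart_chartA p⟩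
    rw [Real.cos_sub_pi_div_two] at hsin
    simpa [hsin, hcos] using Real.sin_sq_add_cos_sq θ
  · exact ⟨0, (rotatedSegment_mem_polarDomain_iff hX).2 (by rwa [sub_zero]), _,
      isPolarChart_chartB p⟩

namespace IsPolarChart

variable {α : ℝ} {e : OpenPartialHomeomorph (PuncturedTorus k) ((Fin k → ℝ) × ℝ)}

theorem coe_toSegments (he : IsPolarChart α e) {p : PuncturedTorus k} (hp : p ∈ e.source) :
    (toSegments p : Fin (k + 1) → ℂ) = rotatedSegment (k + 1) (e p).1 (e p).2 := by
  rw [← he.coe_toSegments_symm _ (e.map_source hp), e.left_inv hp]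

theorem polarChart_toSegments_fst (he : IsPolarChart α e) {p : PuncturedTorus k}
    (hp : p ∈ e.source) : (polarChart k α (toSegments p)).1 = e p := by
  have h := (polarChart k α).right_inv ((he.mem_target_iff _).1 (e.map_source hp))
  rw [he.coe_toSegments hp, ← polarPoint_zero]
  exact congrArg Prod.fst h

theorem polarChart_fst_mem_target (he : IsPolarChart α e) (Z : pointedSegments (k + 1))
    (hZ : Z.1 ∈ polarDomain k α) : (polarChart k α Z).1 ∈ e.target := by
  rw [he.mem_target_iff, (isSliceChart_polarChart k α).fst_apply_zero hZ Z.2]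
  exact (polarChart k α).map_source hZ

theorem toSegments_symm_polarChart_fst (he : IsPolarChart α e) (Z : pointedSegments (k + 1))
    (hZ : Z.1 ∈ polarDomain k α) : toSegments (e.symm (polarChart k α Z).1) = Z := by
  refine Subtype.ext ?_
  rw [he.coe_toSegments_symm _ (he.polarChart_fst_mem_target Z hZ), ← polarPoint_zero, Prod.mk.eta,
    (isSliceChart_polarChart k α).fst_apply_zero hZ Z.2]
  exact (polarChart k α).left_inv hZ

end IsPolarChart

theorem toSegments_injective : Function.Injective (toSegments (k := k)) := by
  intro p q h
  obtain ⟨α, hZ, e, he⟩ := exists_isPolarChart (toSegments p)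
  have hp := he.mem_source p hZ
  have hq := he.mem_source q (h ▸ hZ)
  exact e.injOn hp hq <| by
    rw [← he.polarChart_toSegments_fst hp, ← he.polarChart_toSegments_fst hq, h]

theorem toSegments_surjective : Function.Surjective (toSegments (k := k)) := fun Z =>
  let ⟨_, hZ, _, he⟩ := exists_isPolarChart Z
  ⟨_, he.toSegments_symm_polarChart_fst Z hZ⟩

/-- The map `[X, θ] ↦ (0, e^{iθ} X)` as a bijection. -/
def equivSegments (k : ℕ) : PuncturedTorus k ≃ pointedSegments (k + 1) :=
  Equiv.ofBijective toSegments ⟨toSegments_injective, toSegments_surjective⟩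

theorem contMDiff_coe_toSegments :
    ContMDiff 𝓘(ℝ, (Fin k → ℝ) × ℝ) 𝓘(ℝ, Fin (k + 1) → ℂ) ∞
      (Subtype.val ∘ toSegments : PuncturedTorus k → Fin (k + 1) → ℂ) := by
  intro p
  obtain ⟨α, hZ, e, he⟩ := exists_isPolarChart (toSegments p)
  have hp := he.mem_source p hZ
  refine ContMDiffAt.congr_of_eventuallyEq (contDiff_rotatedSegment.contMDiff.contMDiffAt.comp p
    (contMDiffAt_of_mem_maximalAtlas he.mem_maximalAtlas hp)) ?_
  filter_upwards [e.open_source.mem_nhds hp] with q hq using he.coe_toSegments hq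

theorem contMDiff_equivSegments_symm {E : Type*} [NormedAddCommGroup E] [NormedSpace ℝ E]
    [ChartedSpace E (pointedSegments (k + 1))]
    (hval : ContMDiff 𝓘(ℝ, E) 𝓘(ℝ, Fin (k + 1) → ℂ) ∞
      (Subtype.val : pointedSegments (k + 1) → Fin (k + 1) → ℂ)) :
    ContMDiff 𝓘(ℝ, E) 𝓘(ℝ, (Fin k → ℝ) × ℝ) ∞ (equivSegments k).symm := by
  intro Z
  obtain ⟨α, hZ, e, he⟩ := exists_isPolarChart Z
  have hpolar : ContDiffAt ℝ ∞ (fun W : Fin (k + 1) → ℂ => (polarChart k α W).1) Z :=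
    ((isSliceChart_polarChart k α).contDiffOn.contDiffAt
      ((polarChart k α).open_source.mem_nhds hZ)).fst
  have hcoord := hpolar.contMDiffAt.comp Z hval.contMDiffAt
  refine ContMDiffAt.congr_of_eventuallyEq ((contMDiffAt_symm_of_mem_maximalAtlas
    he.mem_maximalAtlas (he.polarChart_fst_mem_target Z hZ)).comp Z hcoord) ?_
  filter_upwards [((isOpen_polarDomain k α).preimage continuous_subtype_val).mem_nhds hZ] with W hW
  exact (equivSegments k).symm_apply_eq.2 (he.toSegments_symm_polarChart_fst W hW).symm

end PuncturedTorus

end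

theorem theorem2p1_general (k : ℕ) :
    ∃ _ : ChartedSpace (EuclideanSpace ℝ (Fin (k + 1))) (pointedSegments (k + 1)),
      IsManifold (𝓡 (k + 1)) ∞ (pointedSegments (k + 1)) ∧
      Manifold.IsSmoothEmbedding (𝓡 (k + 1)) 𝓘(ℝ, Fin (k + 1) → ℂ) ∞
        (Subtype.val : pointedSegments (k + 1) → (Fin (k + 1) → ℂ)) ∧
      ∃ Ψ : PuncturedTorus k ≃ₘ^∞⟮𝓘(ℝ, (Fin k → ℝ) × ℝ), 𝓡 (k + 1)⟯ pointedSegments (k + 1),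
        ∀ (X : PuncturedSpace k) (θ : Set.Icc (0 : ℝ) Real.pi),
          (Ψ (PuncturedTorus.mk (X, θ)) : Fin (k + 1) → ℂ) = rotatedSegment (k + 1) X.1 θ := by
  have hS := (hasSliceCharts_pointedSegments k).congr
    (.ofFinrankEq (by simp) : ((Fin k → ℝ) × ℝ) ≃L[ℝ] EuclideanSpace ℝ (Fin (k + 1)))
  let _ := hS.chartedSpace
  have hM : IsManifold (𝓡 (k + 1)) ∞ (pointedSegments (k + 1)) := hS.isManifold
  have hE : Manifold.IsSmoothEmbedding (𝓡 (k + 1)) 𝓘(ℝ, Fin (k + 1) → ℂ) ∞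
      (Subtype.val : pointedSegments (k + 1) → Fin (k + 1) → ℂ) :=
    hS.isSmoothEmbedding (.ofFinrankEq (by
      simp [Module.finrank_pi_fintype, Complex.finrank_real_complex, mul_two]))
  exact ⟨_, hM, hE,
    { toEquiv := PuncturedTorus.equivSegments k
      contMDiff_toFun := (ContMDiff.iff_comp_isImmersion hE.isImmersion).2
        ⟨PuncturedTorus.continuous_toSegments, PuncturedTorus.contMDiff_coe_toSegments⟩
      contMDiff_invFun := PuncturedTorus.contMDiff_equivSegments_symm hE.contMDiff },
    fun _ _ => rfl⟩

theorem theorem2p1 (n : ℕ) (hn : 3 ≤ n) :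
    ∃ _ : ChartedSpace (EuclideanSpace ℝ (Fin n)) (pointedSegments n),
      IsManifold (𝓡 n) ∞ (pointedSegments n) ∧
      Manifold.IsSmoothEmbedding (𝓡 n) 𝓘(ℝ, Fin n → ℂ) ∞
        (Subtype.val : pointedSegments n → (Fin n → ℂ)) ∧
      ∃ Ψ : PuncturedTorus (n - 1) ≃ₘ^∞⟮𝓘(ℝ, (Fin (n - 1) → ℝ) × ℝ), 𝓡 n⟯ pointedSegments n,
        ∀ (X : PuncturedSpace (n - 1)) (θ : Set.Icc (0 : ℝ) Real.pi),
          (Ψ (PuncturedTorus.mk (X, θ)) : Fin n → ℂ) = rotatedSegment n X θ := by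
  obtain ⟨k, rfl⟩ : ∃ k, n = k + 1 := ⟨n - 1, by omega⟩
  exact theorem2p1_general k
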